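/- Let $G(x,y)=\frac1{2\pi}\log\frac1{\|x-y\|}$ for $x\ne y$ in $\mathbb R^2$, let $e_1=(1,0)$, $e_2=(0,1)$, and let $\mathcal B=[-\frac12,\frac12]^2$ be the unit cell, with left wall $L=\{-\frac12\}\times[-\frac12,\frac12]$ and bottom wall $D=[-\frac12,\frac12]\times\{-\frac12\}$; the right and top walls are $R=L+e_1$ and $U=D+e_2$, and the normals are $e_1$ on $L,R$ and $e_2$ on $D,U$. Let $\Omega\subset\mathbb R^2$ be a bounded open set whose boundary is a simple closed curve with a regular $2\pi$-periodic $C^1$ parametrization $x(t)$, and suppose that $\overline\Omega$ lies in the open block $(-\frac32,\frac32)^2$ of $3\times3$ unit cells (so $\Omega\subset\mathcal B$ is allowed, and so are inclusions that cross the walls of $\mathcal B$). Write $\int_{\partial\Omega}f\,ds=\int_0^{2\pi}f(x(t))\|x'(t)\|\,dt$ and $|\partial\Omega|=\int_{\partial\Omega}1\,ds$. Given nodes $x_1,\dots,x_N\in\partial\Omega$ with weights $w_1,\dots,w_N\in\mathbb R$, and wall nodes $x_{iL}\in L$, $x_{iD}\in D$ with weight vectors $\mathbf w_L,\mathbf w_D\in\mathbb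 R^m$ ($i=1,\dots,m$), let the Laplace discrepancy matrix be $C=[C_1;C_2;C_3;C_4]\in\mathbb R^{4m\times N}$, where $$(C_1)_{ij}=\sum_{n=-1}^{1}\bigl(G(x_{iL}+e_1,\,x_j-e_1+ne_2)-G(x_{iL},\,x_j+e_1+ne_2)\bigr)w_j,$$ $$(C_2)_{ij}=\sum_{n=-1}^{1}\bigl(\partial_{e_1}G(x_{iL}+e_1,\,x_j-e_1+ne_2)-\partial_{e_1}G(x_{iL},\,x_j+e_1+ne_2)\bigr)w_j,$$ $$(C_3)_{ij}=\sum_{k=-1}^{1}\bigl(G(x_{iD}+e_2,\,x_j+ke_1-e_2)-G(x_{iD},\,x_j+ke_1+e_2)\bigr)w_j,$$ $$(C_4)_{ij}=\sum_{k=-1}^{1}\bigl(\partial_{e_2}G(x_{iD}+e_2,\,x_j+ke_1-e_2)-\partial_{e_2}G(x_{iD},\,x_j+ke_1+e_2)\bigr)w_j,$$ with $\partial_{e}$ the directional derivative in the first argument of $G$. Let $\mathbf w=[\mathbf 0_m;\mathbf w_L;\mathbf 0_m;\mathbf w_D]\in\mathbb R^{4m}$ be the vector of wall consistency weights, and $\mathbf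 1_N\in\mathbb R^N$ the vector of ones. **Lemma.** Suppose that the rules on $\partial\Omega$ (one for each $N$) and the rules on $L$ and on $D$ (one for each $m$) converge to the arc length integral, as $N\to\infty$ and $m\to\infty$ respectively, for each fixed $C^\infty$ integrand (on $\mathbb R^2$, respectively in the coordinate along the wall). Then $$\mathbf w^{T}C\,\mathbf 1_N\;\longrightarrow\;-|\partial\Omega|\qquad\text{as } N,m\to\infty \text{ independently},$$ and there are $N_0,m_0$ such that $\mathbf w^{T}C\,\mathbf 1_N\neq0$ for all $N\ge N_0$ and $m\ge m_0$. The same two conclusions hold, in particular, when the rule on $\partial\Omega$ is the periodic trapezoid rule $x_i=x(2\pi i/N)$, $w_i=\frac{2\pi}N\|x'(2\pi i/N)\|$, and the rules on $L$ and $D$ are the $m$-point Gauss–Legendre rules. -/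

import Mathlib

open Filter Topology
open scoped Real ContDiff Matrix

namespace PeriodicLaplace

/-- The Euclidean plane. -/
abbrev Plane : Type := EuclideanSpace ℝ (Fin 2)

/-- The horizontal lattice vector, carrying the left wall `L` onto the right wall `R`. -/
noncomputable def e₁ : Plane := !₂[1, 0]

/-- The vertical lattice vector, carrying the bottom wall `D` onto the top wall `U`. -/
noncomputable def e₂ : Plane := !₂[0, 1]

/-- The interior of the `3 × 3` block of unit cells whose central cell is
`[-1/2, 1/2] × [-1/2, 1/2]`. -/
def openBlock : Set Plane := {z | ∀ k, z k ∈ Set.Ioo (-(3 / 2) : ℝ) (3 / 2)}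

/-- The fundamental solution `G(x, y) = (1 / 2π) log (1 / ‖x - y‖)` of Laplace's equation. -/
noncomputable def G (x y : Plane) : ℝ := 1 / (2 * π) * Real.log (1 / ‖x - y‖)

/-- The derivative `∂G(x, y) / ∂n` in the target variable `x`, in the direction `n`. -/
noncomputable def dG (n x y : Plane) : ℝ := fderiv ℝ (fun z : Plane => G z y) x n

/-- A bounded planar domain whose boundary is a simple closed regular curve,
with a `2π`-periodic `C¹` parametrization of it. -/
structure Inclusion where
  /-- The domain `Ω`. -/
  Ω : Set Plane
  isOpen : IsOpen Ω
  isBounded : Bornology.IsBounded Ω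
  /-- The parametrization of `∂Ω`. -/
  x : ℝ → Plane
  contDiff : ContDiff ℝ 1 x
  periodic : Function.Periodic x (2 * π)
  deriv_ne_zero : ∀ t, deriv x t ≠ 0
  injOn : Set.InjOn x (Set.Ico 0 (2 * π))
  frontier_eq : frontier Ω = Set.range x

/-- The arc length integral `∫_{∂Ω} f ds`. -/
noncomputable def Inclusion.boundaryIntegral (I : Inclusion) (f : Plane → ℝ) : ℝ :=
  ∫ t in (0 : ℝ)..(2 * π), f (I.x t) * ‖deriv I.x t‖

/-- The perimeter `|∂Ω| = ∫_{∂Ω} 1 ds`. -/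
noncomputable def Inclusion.perimeter (I : Inclusion) : ℝ := I.boundaryIntegral fun _ => 1

/-- `n` nodes in `X` and `n` real weights. -/
structure QuadRule (X : Type) (n : ℕ) where
  node : Fin n → X
  weight : Fin n → ℝ

/-- The quadrature sum of a function. -/
noncomputable def QuadRule.apply {X : Type} {n : ℕ} (q : QuadRule X n) (f : X → ℝ) : ℝ :=
  ∑ i, q.weight i * f (q.node i)

/-- A sequence of quadrature rules with nodes on `∂Ω` which converges to the arc length integral
for every smooth integrand. -/
def IsBoundaryQuadrature (I : Inclusion) (q : (N : ℕ) → QuadRule Plane N) : Prop :=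
  (∀ N i, (q N).node i ∈ frontier I.Ω) ∧
    ∀ f : Plane → ℝ, ContDiff ℝ ∞ f →
      Tendsto (fun N => (q N).apply f) atTop (𝓝 (I.boundaryIntegral f))

/-- A sequence of quadrature rules on the unit interval `[-1/2, 1/2]` (the coordinate along a
wall) which converges to the integral for every smooth integrand. -/
def IsWallQuadrature (q : (m : ℕ) → QuadRule ℝ m) : Prop :=
  (∀ m i, (q m).node i ∈ Set.Icc (-(1 / 2) : ℝ) (1 / 2)) ∧
    ∀ f : ℝ → ℝ, ContDiff ℝ ∞ f →
      Tendsto (fun m => (q m).apply f) atTop (𝓝 (∫ s in (-(1 / 2) : ℝ)..(1 / 2), f s))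

/-- The periodic trapezoid rule on `∂Ω`: `x_i = x(2πi/N)`, `w_i = (2π/N) ‖x'(2πi/N)‖`,
`i = 1, …, N`. -/
noncomputable def Inclusion.trapezoid (I : Inclusion) (N : ℕ) : QuadRule Plane N where
  node i := I.x (2 * π * ((i : ℝ) + 1) / N)
  weight i := 2 * π / N * ‖deriv I.x (2 * π * ((i : ℝ) + 1) / N)‖

/-- The `m`-point Gauss–Legendre rule on `[-1/2, 1/2]`: `m` distinct nodes of the interval, and
exactness for all polynomials of degree at most `2m - 1`. -/
def IsGaussLegendre {m : ℕ} (q : QuadRule ℝ m) : Prop :=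
  Function.Injective q.node ∧
    (∀ i, q.node i ∈ Set.Icc (-(1 / 2) : ℝ) (1 / 2)) ∧
    ∀ p : Polynomial ℝ, p.natDegree < 2 * m →
      q.apply (fun s => p.eval s) = ∫ s in (-(1 / 2) : ℝ)..(1 / 2), p.eval s

/-- The point of the left wall `L = {-1/2} × [-1/2, 1/2]` with coordinate `s`. -/
noncomputable def onL (s : ℝ) : Plane := !₂[-(1 / 2), s]

/-- The point of the bottom wall `D = [-1/2, 1/2] × {-1/2}` with coordinate `s`. -/
noncomputable def onD (s : ℝ) : Plane := !₂[s, -(1 / 2)]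

section discrepancy

variable {N m : ℕ} (q : QuadRule Plane N) (qL qD : QuadRule ℝ m)

/-- Discrepancy of values between `R` and `L`. -/
noncomputable def C₁ : Matrix (Fin m) (Fin N) ℝ := Matrix.of fun i j =>
  (∑ n ∈ Finset.Icc (-1 : ℤ) 1,
    (G (onL (qL.node i) + e₁) (q.node j - e₁ + (n : ℝ) • e₂)
      - G (onL (qL.node i)) (q.node j + e₁ + (n : ℝ) • e₂))) * q.weight j

/-- Discrepancy of normal derivatives between `R` and `L` (both normals are `e₁`). -/
noncomputable def C₂ : Matrix (Fin m) (Fin N) ℝ := Matrix.of fun i j =>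
  (∑ n ∈ Finset.Icc (-1 : ℤ) 1,
    (dG e₁ (onL (qL.node i) + e₁) (q.node j - e₁ + (n : ℝ) • e₂)
      - dG e₁ (onL (qL.node i)) (q.node j + e₁ + (n : ℝ) • e₂))) * q.weight j

/-- Discrepancy of values between `U` and `D`. -/
noncomputable def C₃ : Matrix (Fin m) (Fin N) ℝ := Matrix.of fun i j =>
  (∑ n ∈ Finset.Icc (-1 : ℤ) 1,
    (G (onD (qD.node i) + e₂) (q.node j + (n : ℝ) • e₁ - e₂)
      - G (onD (qD.node i)) (q.node j + (n : ℝ) • e₁ + e₂))) * q.weight j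

/-- Discrepancy of normal derivatives between `U` and `D` (both normals are `e₂`). -/
noncomputable def C₄ : Matrix (Fin m) (Fin N) ℝ := Matrix.of fun i j =>
  (∑ n ∈ Finset.Icc (-1 : ℤ) 1,
    (dG e₂ (onD (qD.node i) + e₂) (q.node j + (n : ℝ) • e₁ - e₂)
      - dG e₂ (onD (qD.node i)) (q.node j + (n : ℝ) • e₁ + e₂))) * q.weight j

/-- The Laplace discrepancy matrix `C = [C₁; C₂; C₃; C₄]`, of size `4m × N`. -/
noncomputable def discrepancyMatrix :
    Matrix (Fin m ⊕ Fin m ⊕ Fin m ⊕ Fin m) (Fin N) ℝ :=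
  Matrix.fromRows (C₁ q qL) (Matrix.fromRows (C₂ q qL) (Matrix.fromRows (C₃ q qD) (C₄ q qD)))

/-- The wall consistency vector `w = [0; w_L; 0; w_D]`. -/
def wallWeights : Fin m ⊕ Fin m ⊕ Fin m ⊕ Fin m → ℝ :=
  Sum.elim 0 (Sum.elim qL.weight (Sum.elim 0 qD.weight))

/-- The number `wᵀ C 1_N`. -/
noncomputable def fluxSum : ℝ :=
  wallWeights qL qD ⬝ᵥ (discrepancyMatrix q qL qD *ᵥ (1 : Fin N → ℝ))

end discrepancy

end PeriodicLaplace

open PeriodicLaplace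

/-! For a fixed source in the block, only normal-derivative discrepancies carry weight. Translating
the three image rows or columns tiles each side of the 3 × 3 block by three unit walls, so the
integrated wall terms give the flux of the source out of the block. By Gauss's law this is -1;
concretely, it is a sum of arctangents that pair off by `arctan x + arctan x⁻¹ = π / 2`. With exact
wall integrals, wᵀC1 is thus minus the boundary rule applied to 1, which tends to minus the
perimeter.

The difficulty is that N and m grow independently, while the weights are signed and no bound on the
sum of their absolute values is available. Joint convergence on a kernel of both variables therefore
does not follow by mere approximation. The kernel is the real part of 1/z = ∫ exp(-tz) dt over t >
0, with z affine in the wall coordinate plus a function of the source, so each exponential factors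
into a wall part and a boundary part. Banach–Steinhaus on ℓ¹ Dirichlet series bounds both quadrature
factors uniformly in t and in the rule (`exists_bound_applyComplex_exp`). Dominated convergence then
gives a joint limit (`exists_tendsto_halfPlaneKernel`), identified by letting m → ∞ first and N → ∞
next (`tendsto_fluxSum`). -/

namespace PeriodicLaplace

/-! ### Uniform bounds on exponentials from convergence on smooth functions. -/

/-- The quadrature sum of a complex-valued function. -/
noncomputable def QuadRule.applyComplex {X : Type} {n : ℕ} (q : QuadRule X n) (f : X → ℂ) : ℂ :=
  ∑ i, (q.weight i : ℂ) * f (q.node i)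

theorem QuadRule.applyComplex_eq {X : Type} {n : ℕ} (q : QuadRule X n) (f : X → ℂ) :
    q.applyComplex f =
      ((q.apply fun x => (f x).re : ℝ) : ℂ) + ((q.apply fun x => (f x).im : ℝ) : ℂ) * Complex.I := by
  simp only [QuadRule.applyComplex, QuadRule.apply, Complex.ofReal_sum, Finset.sum_mul,
    ← Finset.sum_add_distrib]
  refine Finset.sum_congr rfl fun i _ => ?_
  conv_lhs => rw [← Complex.re_add_im (f (q.node i))]
  push_cast
  ring

section Bound

variable {E : Type} [NormedAddCommGroup E] [NormedSpace ℝ E]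

theorem exists_tendsto_applyComplex {q : (N : ℕ) → QuadRule E N} {T : (E → ℝ) → ℝ}
    (hq : ∀ f : E → ℝ, ContDiff ℝ ∞ f → Tendsto (fun N => (q N).apply f) atTop (𝓝 (T f)))
    {f : E → ℂ} (hf : ContDiff ℝ ∞ f) :
    ∃ l, Tendsto (fun N => (q N).applyComplex f) atTop (𝓝 l) := by
  simp only [QuadRule.applyComplex_eq]
  have hre : ContDiff ℝ ∞ fun x => (f x).re := Complex.reCLM.contDiff.comp hf
  have him : ContDiff ℝ ∞ fun x => (f x).im := Complex.imCLM.contDiff.comp hf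
  exact ⟨_, ((Complex.continuous_ofReal.tendsto _).comp (hq _ hre)).add
    (((Complex.continuous_ofReal.tendsto _).comp (hq _ him)).mul_const _)⟩

/-- A holomorphic function of a smooth function `Z` is smooth after multiplication by a cutoff
which equals `1` where `c ≤ Re Z`. -/
theorem exists_contDiff_eq_comp {Z : E → ℂ} (hZ : ContDiff ℝ ∞ Z) {H : ℂ → ℂ}
    (hH : DifferentiableOn ℂ H {z | 0 < z.re}) {c : ℝ} (hc : 0 < c) :
    ∃ f : E → ℂ, ContDiff ℝ ∞ f ∧ ∀ x, c ≤ (Z x).re → f x = H (Z x) := by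
  have hopen : IsOpen {z : ℂ | 0 < z.re} := isOpen_lt continuous_const Complex.continuous_re
  have hre : ContDiff ℝ ∞ fun x => (Z x).re := Complex.reCLM.contDiff.comp hZ
  -- The argument is ≤ 0 for Re Z ≤ c/2 and ≥ 1 for Re Z ≥ c, so the product vanishes near every
  -- point where `H` may fail to be holomorphic.
  refine ⟨fun x => (Real.smoothTransition ((2 / c) * (Z x).re - 1) : ℝ) * H (Z x), ?_, ?_⟩
  · rw [contDiff_iff_contDiffAt]
    intro x
    by_cases hx : 0 < (Z x).re
    · refine ContDiffAt.mul ?_ ?_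
      · exact Complex.ofRealCLM.contDiff.contDiffAt.comp x (Real.smoothTransition.contDiff.comp ((contDiff_const.mul hre).sub
          contDiff_const)).contDiffAt
      · have h1 : ContDiffAt ℂ ∞ H (Z x) := (hH.contDiffOn hopen).contDiffAt (hopen.mem_nhds hx)
        exact (h1.restrict_scalars ℝ).comp x hZ.contDiffAt
    · have hlt : (Z x).re < c / 2 := by linarith
      have hev : ∀ᶠ y in 𝓝 x, (Z y).re < c / 2 :=
        (hre.continuous.tendsto x).eventually_lt_const hlt
      refine (contDiffAt_const (c := (0 : ℂ))).congr_of_eventuallyEq ?_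
      filter_upwards [hev] with y hy
      rw [Real.smoothTransition.zero_of_nonpos, Complex.ofReal_zero, zero_mul]
      have : 2 / c * (Z y).re ≤ 2 / c * (c / 2) := by gcongr
      rw [show 2 / c * (c / 2) = 1 by field_simp] at this
      linarith
  · intro x hx
    simp only
    rw [Real.smoothTransition.one_of_one_le, Complex.ofReal_one, one_mul]
    have : 2 / c * c ≤ 2 / c * (Z x).re := by gcongr
    rw [show 2 / c * c = 2 by field_simp] at this
    linarith

theorem norm_mul_exp_le (a : ℂ) (t : NNReal) {z : ℂ} (hz : 0 ≤ z.re) :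
    ‖a * Complex.exp (-((t : ℝ) * z))‖ ≤ ‖a‖ := by
  rw [norm_mul, Complex.norm_exp]
  refine mul_le_of_le_one_right (norm_nonneg _) (Real.exp_le_one_iff.2 ?_)
  have : 0 ≤ (t : ℝ) * z.re := by positivity
  simpa using this

theorem summable_norm_lp_one (a : lp (fun _ : NNReal => ℂ) 1) : Summable fun t => ‖a t‖ := by
  have := (memℓp_gen_iff (p := 1) (by simp)).1 (lp.memℓp a)
  simpa using this

/-- Evaluation at `z` of the Dirichlet series `∑ a_t exp (-t z)` with coefficients in `ℓ¹`. -/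
noncomputable def dirichletEval (z : ℂ) (hz : 0 ≤ z.re) : lp (fun _ : NNReal => ℂ) 1 →L[ℂ] ℂ :=
  LinearMap.mkContinuous
    { toFun := fun a => ∑' t : NNReal, a t * Complex.exp (-((t : ℝ) * z))
      map_add' := fun a b => by
        rw [← Summable.tsum_add]
        · simp only [lp.coeFn_add, Pi.add_apply, add_mul]
        · exact (Summable.of_norm_bounded (summable_norm_lp_one a)
            fun t => norm_mul_exp_le _ _ hz)
        · exact (Summable.of_norm_bounded (summable_norm_lp_one b)
            fun t => norm_mul_exp_le _ _ hz)
      map_smul' := fun c a => by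
        simp only [lp.coeFn_smul, Pi.smul_apply, smul_eq_mul, RingHom.id_apply, mul_assoc,
          tsum_mul_left] }
    1 (fun a => by
      have h := tsum_of_norm_bounded (summable_norm_lp_one a).hasSum
        fun t => norm_mul_exp_le (a t) t hz
      have h2 : ‖a‖ = ∑' t, ‖a t‖ := by
        simpa using lp.norm_eq_tsum_rpow (p := 1) (by simp) a
      simpa [h2] using h)

theorem dirichletEval_apply (z : ℂ) (hz : 0 ≤ z.re) (a : lp (fun _ : NNReal => ℂ) 1) :
    dirichletEval z hz a = ∑' t : NNReal, a t * Complex.exp (-((t : ℝ) * z)) := rfl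

theorem dirichletEval_single (z : ℂ) (hz : 0 ≤ z.re) (t : NNReal) :
    dirichletEval z hz (lp.single 1 t 1) = Complex.exp (-((t : ℝ) * z)) := by
  classical
  rw [dirichletEval_apply, tsum_eq_single t]
  · simp
  · intro s hs
    simp [hs]

/-- Quadrature rules which converge on smooth functions are uniformly bounded on the family
`exp (-t Z)`, `t ≥ 0`. -/
theorem exists_bound_applyComplex_exp {q : (N : ℕ) → QuadRule E N} {T : (E → ℝ) → ℝ}
    (hq : ∀ f : E → ℝ, ContDiff ℝ ∞ f → Tendsto (fun N => (q N).apply f) atTop (𝓝 (T f)))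
    {Z : E → ℂ} (hZ : ContDiff ℝ ∞ Z) {c : ℝ} (hc : 0 < c)
    (hqZ : ∀ N i, c ≤ (Z ((q N).node i)).re) :
    ∃ C : ℝ, ∀ N, ∀ t : ℝ, 0 ≤ t →
      ‖(q N).applyComplex fun x => Complex.exp (-(t * Z x))‖ ≤ C := by
  have h0 : ∀ N i, 0 ≤ (Z ((q N).node i)).re := fun N i => hc.le.trans (hqZ N i)
  -- The rule `q N` viewed as a functional on coefficient sequences. The Banach space ℓ¹ stands in
  -- for the smooth functions, where Banach–Steinhaus would involve infinitely many seminorms.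
  let g : ℕ → lp (fun _ : NNReal => ℂ) 1 →L[ℂ] ℂ := fun N =>
    ∑ i, ((q N).weight i : ℂ) • dirichletEval (Z ((q N).node i)) (h0 N i)
  have hg : ∀ a, ∃ C, ∀ N, ‖g N a‖ ≤ C := by
    intro a
    have hH : DifferentiableOn ℂ
        (fun z : ℂ => ∑' t : NNReal, a t * Complex.exp (-((t : ℝ) * z))) {z | 0 < z.re} := by
      refine Complex.differentiableOn_tsum_of_summable_norm (summable_norm_lp_one a) (fun t => ?_)
        (isOpen_lt continuous_const Complex.continuous_re)
        fun t z hz => norm_mul_exp_le _ _ (le_of_lt hz)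
      fun_prop
    -- The series is holomorphic only for Re z > 0; the cutoff makes it smooth on all of `E` without
    -- changing its values at the nodes.
    obtain ⟨f, hf, hfe⟩ := exists_contDiff_eq_comp hZ hH hc
    obtain ⟨l, hl⟩ := exists_tendsto_applyComplex hq hf
    obtain ⟨C, hC⟩ := (Metric.isBounded_range_of_tendsto _ hl).exists_norm_le
    refine ⟨C, fun N => ?_⟩
    have : g N a = (q N).applyComplex f := by
      simp only [g, QuadRule.applyComplex, sum_apply,
        smul_apply, smul_eq_mul, dirichletEval_apply]
      exact Finset.sum_congr rfl fun i _ => by rw [hfe _ (hqZ N i)]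
    rw [this]
    exact hC _ ⟨N, rfl⟩
  obtain ⟨C, hC⟩ := banach_steinhaus hg
  refine ⟨C, fun N t ht => ?_⟩
  lift t to NNReal using ht
  -- Unit vectors of ℓ¹ all have norm 1, hence the bound does not depend on t.
  have h1 : g N (lp.single 1 t 1) =
      (q N).applyComplex fun x => Complex.exp (-(t * Z x)) := by
    simp only [g, QuadRule.applyComplex, sum_apply,
      smul_apply, smul_eq_mul, dirichletEval_single]
  rw [← h1]
  refine ((g N).le_opNorm _).trans ?_
  rw [lp.norm_single (by simp)]
  simpa using hC N

end Bound

/-! ### Separation of variables by the Laplace transform, and joint convergence. -/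

/-- The Poisson kernel of the half plane, up to the factor `1 / π`. -/
noncomputable def halfPlaneKernel (a b : ℝ) : ℝ := a / (a ^ 2 + b ^ 2)

theorem integrableOn_exp_neg_mul {z : ℂ} (hz : 0 < z.re) :
    MeasureTheory.IntegrableOn (fun t : ℝ => Complex.exp (-(t * z))) (Set.Ioi 0) := by
  have := integrableOn_exp_mul_complex_Ioi (a := -z) (by simpa using hz) 0
  refine this.congr_fun (fun t _ => ?_) measurableSet_Ioi
  simp only
  congr 1
  ring

theorem integral_exp_neg_mul {z : ℂ} (hz : 0 < z.re) :
    ∫ t : ℝ in Set.Ioi 0, Complex.exp (-(t * z)) = z⁻¹ := by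
  have := integral_exp_mul_complex_Ioi (a := -z) (by simpa using hz) 0
  simp only [Complex.ofReal_zero, mul_zero, Complex.exp_zero, neg_div_neg_eq, one_div] at this
  rw [← this]
  congr 1
  ext t
  congr 1
  ring

theorem halfPlaneKernel_eq_re (a b : ℝ) :
    halfPlaneKernel a b = ((a + b * Complex.I : ℂ)⁻¹).re := by
  simp [halfPlaneKernel, Complex.inv_re, Complex.normSq_apply, sq]

/-- The quadrature sum of a half plane kernel in both variables, as a superposition of products
of quadrature sums. -/
theorem apply_apply_halfPlaneKernel {E : Type} {N m : ℕ} (q : QuadRule E N) (r : QuadRule ℝ m)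
    {A B : E → ℝ} {δ : ℝ} (hA : ∀ i, δ ≤ A (q.node i)) (hδ : 0 < δ) :
    r.apply (fun s => q.apply fun y => halfPlaneKernel (A y) (s - B y)) =
      (∫ t : ℝ in Set.Ioi 0, Complex.exp (-(t * (δ / 4 : ℝ))) *
        r.applyComplex (fun s => Complex.exp (-(t * ((δ / 4 : ℝ) + s * Complex.I)))) *
        q.applyComplex fun y =>
          Complex.exp (-(t * ((A y - δ / 2 : ℝ) - B y * Complex.I)))).re := by
  have hpos : ∀ i j, 0 < ((A (q.node j) : ℂ) + (r.node i - B (q.node j) : ℝ) * Complex.I).re :=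
    fun i j => by simpa using hδ.trans_le (hA j)
  have h : ∀ t : ℝ, Complex.exp (-(t * (δ / 4 : ℝ))) *
        r.applyComplex (fun s => Complex.exp (-(t * ((δ / 4 : ℝ) + s * Complex.I)))) *
        (q.applyComplex fun y =>
          Complex.exp (-(t * ((A y - δ / 2 : ℝ) - B y * Complex.I)))) =
      ∑ i, ∑ j, ((r.weight i * q.weight j : ℝ) : ℂ) *
        Complex.exp (-(t * ((A (q.node j) : ℂ) + (r.node i - B (q.node j) : ℝ) * Complex.I))) := by
    intro t
    simp only [QuadRule.applyComplex, Finset.mul_sum, Finset.sum_mul]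
    rw [Finset.sum_comm]
    refine Finset.sum_congr rfl fun i _ => Finset.sum_congr rfl fun j _ => ?_
    -- The real part A is split as δ/4 + δ/4 + (A - δ/2): one quarter of δ is kept for integrability
    -- in t, one keeps the wall exponent in the open right half plane, and the remainder is still at
    -- least δ/2 at the nodes.
    rw [show -((t : ℂ) * ((A (q.node j) : ℂ) + (r.node i - B (q.node j) : ℝ) * Complex.I)) =
      -(t * (δ / 4 : ℝ)) + -(t * ((δ / 4 : ℝ) + r.node i * Complex.I)) +
        -(t * ((A (q.node j) - δ / 2 : ℝ) - B (q.node j) * Complex.I)) by push_cast; ring,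
      Complex.exp_add, Complex.exp_add]
    push_cast
    ring
  simp only [h]
  rw [MeasureTheory.integral_finsetSum _ fun i _ => MeasureTheory.integrable_finsetSum _
    fun j _ => (integrableOn_exp_neg_mul (hpos i j)).const_mul _]
  simp only [QuadRule.apply, Complex.re_sum, Finset.mul_sum]
  refine Finset.sum_congr rfl fun i _ => ?_
  rw [MeasureTheory.integral_finsetSum _ fun j _ =>
    (integrableOn_exp_neg_mul (hpos i j)).const_mul _, Complex.re_sum]
  refine Finset.sum_congr rfl fun j _ => ?_
  rw [MeasureTheory.integral_const_mul, integral_exp_neg_mul (hpos i j), Complex.re_ofReal_mul,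
    halfPlaneKernel_eq_re, mul_assoc]

theorem continuous_applyComplex_exp {X : Type} {n : ℕ} (q : QuadRule X n) (Z : X → ℂ) :
    Continuous fun t : ℝ => q.applyComplex fun x => Complex.exp (-(t * Z x)) := by
  unfold QuadRule.applyComplex
  fun_prop

section Joint

variable {E : Type} [NormedAddCommGroup E] [NormedSpace ℝ E]

/-- Two families of quadrature rules which converge on smooth functions converge jointly on the
half plane kernel. -/
theorem exists_tendsto_halfPlaneKernel {q : (N : ℕ) → QuadRule E N} {T : (E → ℝ) → ℝ}
    (hq : ∀ f : E → ℝ, ContDiff ℝ ∞ f → Tendsto (fun N => (q N).apply f) atTop (𝓝 (T f)))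
    {r : (m : ℕ) → QuadRule ℝ m} {T' : (ℝ → ℝ) → ℝ}
    (hr : ∀ f : ℝ → ℝ, ContDiff ℝ ∞ f → Tendsto (fun m => (r m).apply f) atTop (𝓝 (T' f)))
    {A B : E → ℝ} (hAs : ContDiff ℝ ∞ A) (hBs : ContDiff ℝ ∞ B) {δ : ℝ} (hδ : 0 < δ)
    (hA : ∀ N i, δ ≤ A ((q N).node i)) :
    ∃ l, Tendsto (fun p : ℕ × ℕ => (r p.2).apply fun s => (q p.1).apply fun y =>
      halfPlaneKernel (A y) (s - B y)) (atTop ×ˢ atTop) (𝓝 l) := by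
  have hZ : ContDiff ℝ ∞ fun y : E => ((A y - δ / 2 : ℝ) : ℂ) - B y * Complex.I := by
    have hAc : ContDiff ℝ ∞ fun y : E => ((A y - δ / 2 : ℝ) : ℂ) :=
      Complex.ofRealCLM.contDiff.comp (hAs.sub contDiff_const)
    have hBc : ContDiff ℝ ∞ fun y : E => (B y : ℂ) := Complex.ofRealCLM.contDiff.comp hBs
    exact hAc.sub (hBc.mul contDiff_const)
  have hW : ContDiff ℝ ∞ fun s : ℝ => ((δ / 4 : ℝ) : ℂ) + s * Complex.I :=
    contDiff_const.add (Complex.ofRealCLM.contDiff.mul contDiff_const)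
  obtain ⟨C, hC⟩ := exists_bound_applyComplex_exp hq hZ (c := δ / 2) (by positivity)
    fun N i => by simpa using by linarith [hA N i]
  obtain ⟨C', hC'⟩ := exists_bound_applyComplex_exp hr hW (c := δ / 4) (by positivity)
    fun N i => by simp
  have hexp : ∀ {F : Type} [NormedAddCommGroup F] [NormedSpace ℝ F] {Z : F → ℂ} (t : ℝ),
      ContDiff ℝ ∞ Z → ContDiff ℝ ∞ fun x => Complex.exp (-(t * Z x)) := fun t hZ =>
    (contDiff_const.mul hZ).neg.cexp
  choose v hv using fun t : ℝ => exists_tendsto_applyComplex hq (hexp t hZ)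
  choose u hu using fun t : ℝ => exists_tendsto_applyComplex hr (hexp t hW)
  simp only [fun p : ℕ × ℕ => apply_apply_halfPlaneKernel (q p.1) (r p.2) (B := B) (hA p.1) hδ]
  refine ⟨_, (Complex.continuous_re.tendsto _).comp
    (MeasureTheory.tendsto_integral_filter_of_dominated_convergence
      (f := fun t : ℝ => Complex.exp (-(t * (δ / 4 : ℝ))) * u t * v t)
      -- The reserved factor exp(-tδ/4) supplies the integrable majorant; the two quadrature factors
      -- contribute only constants.
      (fun t : ℝ => ‖Complex.exp (-(t * (δ / 4 : ℝ)))‖ * C' * C) ?_ ?_ ?_ ?_)⟩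
  · refine Eventually.of_forall fun p => Continuous.aestronglyMeasurable ?_
    refine (Continuous.mul (by fun_prop) ?_).mul ?_
    · exact continuous_applyComplex_exp (r p.2) _
    · exact continuous_applyComplex_exp (q p.1) _
  · refine Eventually.of_forall fun p => ?_
    filter_upwards [MeasureTheory.ae_restrict_mem measurableSet_Ioi] with t ht
    rw [norm_mul, norm_mul]
    have h1 := hC' p.2 t (le_of_lt ht)
    have h2 := hC p.1 t (le_of_lt ht)
    have := (norm_nonneg _).trans h1
    gcongr
  · exact ((integrableOn_exp_neg_mul (by simpa using by positivity)).norm.mul_const _).mul_const _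
  · refine Eventually.of_forall fun t => ?_
    exact (((hu t).comp tendsto_snd).const_mul _).mul ((hv t).comp tendsto_fst)

end Joint

/-! ### The discrepancy entries in terms of half plane kernels. -/

theorem dG_eq (n : Plane) {x y : Plane} (hxy : x ≠ y) :
    dG n x y = -(1 / (2 * π)) * (inner ℝ (x - y) n / ‖x - y‖ ^ 2) := by
  have hne : ‖x - y‖ ^ 2 ≠ 0 := by simpa [sub_eq_zero] using hxy
  have h1 : HasFDerivAt (fun z : Plane => ‖z - y‖ ^ 2) (2 • innerSL ℝ (x - y)) x := by
    simpa using ((hasFDerivAt_id x).sub_const y).norm_sq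
  -- The factor 1/2 comes from log ‖·‖ = ½ log ‖·‖², used because the squared norm has a polynomial
  -- derivative.
  have h2 := (h1.log hne).const_mul (-(1 / (2 * π)) * (1 / 2))
  have h3 : (fun z : Plane => G z y) =
      fun z => -(1 / (2 * π)) * (1 / 2) * Real.log (‖z - y‖ ^ 2) := by
    ext z
    rw [G, one_div ‖z - y‖, Real.log_inv, Real.log_pow]
    push_cast
    ring
  rw [dG, h3, h2.fderiv]
  simp only [smul_apply, innerSL_apply_apply, smul_eq_mul, nsmul_eq_mul]
  push_cast
  field_simp

theorem plane_norm_sq (z : Plane) : ‖z‖ ^ 2 = z 0 ^ 2 + z 1 ^ 2 := by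
  simp [EuclideanSpace.norm_sq_eq, Fin.sum_univ_two]

theorem dG_e₁ {x y : Plane} (h : x 0 - y 0 ≠ 0) :
    dG e₁ x y = -(1 / (2 * π)) * halfPlaneKernel (x 0 - y 0) (x 1 - y 1) := by
  rw [dG_eq _ (by rintro rfl; simp at h), plane_norm_sq]
  simp [e₁, halfPlaneKernel, PiLp.inner_apply, Fin.sum_univ_two]

theorem dG_e₂ {x y : Plane} (h : x 1 - y 1 ≠ 0) :
    dG e₂ x y = -(1 / (2 * π)) * halfPlaneKernel (x 1 - y 1) (x 0 - y 0) := by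
  rw [dG_eq _ (by rintro rfl; simp at h), plane_norm_sq]
  simp [e₂, halfPlaneKernel, PiLp.inner_apply, Fin.sum_univ_two, add_comm]

theorem halfPlaneKernel_neg (a b : ℝ) : halfPlaneKernel (-a) b = -halfPlaneKernel a b := by
  simp [halfPlaneKernel, neg_div]

/-- The flux through the wall with coordinate `s`, at signed distances `3/2 - u`, `3/2 + u` from
the outer images of a source with tangential coordinate `v`, up to the factor `-1 / 2π`. -/
noncomputable def wallKernel (u v s : ℝ) : ℝ :=
  ∑ n ∈ Finset.Icc (-1 : ℤ) 1,
    (halfPlaneKernel (3 / 2 - u) (s - (v + n)) + halfPlaneKernel (3 / 2 + u) (s - (v + n)))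

theorem C₂_apply {N m : ℕ} (q : QuadRule Plane N) (r : QuadRule ℝ m)
    (hq : ∀ j, q.node j ∈ openBlock) (i : Fin m) (j : Fin N) :
    C₂ q r i j = -(1 / (2 * π)) *
      (q.weight j * wallKernel (q.node j 0) (q.node j 1) (r.node i)) := by
  have h := hq j 0
  have hR : (3 / 2 : ℝ) - q.node j 0 ≠ 0 := by linarith [h.2]
  have hL : -((3 / 2 : ℝ) + q.node j 0) ≠ 0 := by linarith [h.1]
  simp only [C₂, Matrix.of_apply, wallKernel, Finset.mul_sum, Finset.sum_mul]
  refine Finset.sum_congr rfl fun n _ => ?_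
  have h1 : (onL (r.node i) + e₁) 0 - (q.node j - e₁ + (n : ℝ) • e₂) 0 = 3 / 2 - q.node j 0 := by
    simp [onL, e₁, e₂]; ring
  have h2 : onL (r.node i) 0 - (q.node j + e₁ + (n : ℝ) • e₂) 0 = -(3 / 2 + q.node j 0) := by
    simp [onL, e₁, e₂]; ring
  have h3 : (onL (r.node i) + e₁) 1 - (q.node j - e₁ + (n : ℝ) • e₂) 1 =
    r.node i - (q.node j 1 + n) := by simp [onL, e₁, e₂]
  have h4 : onL (r.node i) 1 - (q.node j + e₁ + (n : ℝ) • e₂) 1 =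
    r.node i - (q.node j 1 + n) := by simp [onL, e₁, e₂]
  -- The kernel is odd in the normal distance, so the subtracted term on `L`, at negative distance,
  -- becomes an added one.
  rw [dG_e₁ (by rwa [h1]), dG_e₁ (by rwa [h2]), h1, h2, h3, h4, halfPlaneKernel_neg]
  ring

theorem C₄_apply {N m : ℕ} (q : QuadRule Plane N) (r : QuadRule ℝ m)
    (hq : ∀ j, q.node j ∈ openBlock) (i : Fin m) (j : Fin N) :
    C₄ q r i j = -(1 / (2 * π)) *
      (q.weight j * wallKernel (q.node j 1) (q.node j 0) (r.node i)) := by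
  have h := hq j 1
  have hR : (3 / 2 : ℝ) - q.node j 1 ≠ 0 := by linarith [h.2]
  have hL : -((3 / 2 : ℝ) + q.node j 1) ≠ 0 := by linarith [h.1]
  simp only [C₄, Matrix.of_apply, wallKernel, Finset.mul_sum, Finset.sum_mul]
  refine Finset.sum_congr rfl fun n _ => ?_
  have h1 : (onD (r.node i) + e₂) 1 - (q.node j + (n : ℝ) • e₁ - e₂) 1 = 3 / 2 - q.node j 1 := by
    simp [onD, e₁, e₂]; ring
  have h2 : onD (r.node i) 1 - (q.node j + (n : ℝ) • e₁ + e₂) 1 = -(3 / 2 + q.node j 1) := by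
    simp [onD, e₁, e₂]; ring
  have h3 : (onD (r.node i) + e₂) 0 - (q.node j + (n : ℝ) • e₁ - e₂) 0 =
    r.node i - (q.node j 0 + n) := by simp [onD, e₁, e₂]
  have h4 : onD (r.node i) 0 - (q.node j + (n : ℝ) • e₁ + e₂) 0 =
    r.node i - (q.node j 0 + n) := by simp [onD, e₁, e₂]
  rw [dG_e₂ (by rwa [h1]), dG_e₂ (by rwa [h2]), h1, h2, h3, h4, halfPlaneKernel_neg]
  ring

/-- The zero blocks of the consistency vector remove the discrepancies of values; only fluxes
remain. -/
theorem fluxSum_eq {N m : ℕ} (q : QuadRule Plane N) (qL qD : QuadRule ℝ m)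
    (hq : ∀ j, q.node j ∈ openBlock) :
    fluxSum q qL qD = -(1 / (2 * π)) *
      (qL.apply (fun s => q.apply fun y => wallKernel (y 0) (y 1) s) +
        qD.apply fun s => q.apply fun y => wallKernel (y 1) (y 0) s) := by
  simp only [fluxSum, wallWeights, discrepancyMatrix, dotProduct, Fintype.sum_sum_type,
    Sum.elim_inl, Sum.elim_inr, Pi.zero_apply, zero_mul, Finset.sum_const_zero, zero_add,
    Matrix.mulVec, Matrix.fromRows_apply_inl, Matrix.fromRows_apply_inr, Pi.one_apply, mul_one,
    C₂_apply q qL hq, C₄_apply q qD hq, QuadRule.apply, mul_add, Finset.mul_sum]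
  congr 1 <;>
  exact Finset.sum_congr rfl fun i _ => Finset.sum_congr rfl fun j _ => by ring

/-! ### Exact wall integrals: Gauss's law for the block. -/

theorem halfPlaneKernel_denom_pos {a : ℝ} (ha : 0 < a) (b : ℝ) : 0 < a ^ 2 + b ^ 2 := by
  positivity

theorem contDiff_halfPlaneKernel {a : ℝ} (ha : 0 < a) (b : ℝ) :
    ContDiff ℝ ∞ fun s => halfPlaneKernel a (s - b) :=
  contDiff_const.div (contDiff_const.add ((contDiff_id.sub contDiff_const).pow 2))
    fun s => (halfPlaneKernel_denom_pos ha (s - b)).ne'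

theorem integral_halfPlaneKernel {a : ℝ} (ha : 0 < a) (b c d : ℝ) :
    ∫ s in c..d, halfPlaneKernel a (s - b) =
      Real.arctan ((d - b) / a) - Real.arctan ((c - b) / a) := by
  refine intervalIntegral.integral_eq_sub_of_hasDerivAt
    (f := fun s => Real.arctan ((s - b) / a)) (fun s _ => ?_)
    (contDiff_halfPlaneKernel ha b).continuous.continuousOn.intervalIntegrable
  have h := (((hasDerivAt_id s).sub_const b).div_const a).arctan
  refine h.congr_deriv ?_
  have := halfPlaneKernel_denom_pos ha (s - b)
  simp only [halfPlaneKernel, id]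
  field_simp

theorem sum_Icc_neg_one_one (f : ℤ → ℝ) :
    ∑ n ∈ Finset.Icc (-1 : ℤ) 1, f n = f (-1) + f 0 + f 1 := by
  rw [show Finset.Icc (-1 : ℤ) 1 = {-1, 0, 1} by decide]
  simp [add_assoc]

theorem contDiff_wallKernel {u : ℝ} (hu : u ∈ Set.Ioo (-(3 / 2) : ℝ) (3 / 2)) (v : ℝ) :
    ContDiff ℝ ∞ (wallKernel u v) := by
  unfold wallKernel
  exact ContDiff.sum fun n _ => (contDiff_halfPlaneKernel (by linarith [hu.2]) _).add
    (contDiff_halfPlaneKernel (by linarith [hu.1]) _)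

/-- The three unit translates tile a segment of length 3, so the sum telescopes to the angles that
two opposite sides of the block subtend at the source. -/
theorem integral_wallKernel {u : ℝ} (hu : u ∈ Set.Ioo (-(3 / 2) : ℝ) (3 / 2)) (v : ℝ) :
    ∫ s in (-(1 / 2) : ℝ)..(1 / 2), wallKernel u v s =
      Real.arctan ((3 / 2 - v) / (3 / 2 - u)) + Real.arctan ((3 / 2 + v) / (3 / 2 - u)) +
      (Real.arctan ((3 / 2 - v) / (3 / 2 + u)) + Real.arctan ((3 / 2 + v) / (3 / 2 + u))) := by
  have h1 : 0 < 3 / 2 - u := by linarith [hu.2]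
  have h2 : 0 < 3 / 2 + u := by linarith [hu.1]
  have hi : ∀ {a : ℝ}, 0 < a → ∀ b, IntervalIntegrable (fun s => halfPlaneKernel a (s - b))
      MeasureTheory.volume (-(1 / 2)) (1 / 2) := fun ha b =>
    (contDiff_halfPlaneKernel ha b).continuous.intervalIntegrable _ _
  have key : ∀ {a : ℝ}, 0 < a → ∑ n ∈ Finset.Icc (-1 : ℤ) 1,
      ∫ s in (-(1 / 2) : ℝ)..(1 / 2), halfPlaneKernel a (s - (v + n)) =
        Real.arctan ((3 / 2 - v) / a) + Real.arctan ((3 / 2 + v) / a) := by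
    intro a ha
    simp only [integral_halfPlaneKernel ha, sum_Icc_neg_one_one]
    push_cast
    -- The first two rewrites match the common endpoints of neighbouring translates; the others name
    -- the two extreme endpoints.
    rw [show (1 / 2 : ℝ) - (v + 0) = -(1 / 2) - (v + -1) by ring,
      show (1 / 2 : ℝ) - (v + 1) = -(1 / 2) - (v + 0) by ring,
      show (1 / 2 : ℝ) - (v + -1) = 3 / 2 - v by ring,
      show -(1 / 2 : ℝ) - (v + 1) = -(3 / 2 + v) by ring, neg_div, Real.arctan_neg]
    ring
  simp only [wallKernel]
  rw [intervalIntegral.integral_finsetSum fun n _ => (hi h1 _).add (hi h2 _)]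
  simp only [fun n : ℤ => intervalIntegral.integral_add (hi h1 (v + n)) (hi h2 (v + n)),
    Finset.sum_add_distrib, key h1, key h2]

/-- The total flux through the four walls of the unit cell. -/
theorem integral_wallKernel_add {u v : ℝ} (hu : u ∈ Set.Ioo (-(3 / 2) : ℝ) (3 / 2))
    (hv : v ∈ Set.Ioo (-(3 / 2) : ℝ) (3 / 2)) :
    (∫ s in (-(1 / 2) : ℝ)..(1 / 2), wallKernel u v s) +
      ∫ s in (-(1 / 2) : ℝ)..(1 / 2), wallKernel v u s = 2 * π := by
  have key : ∀ {a b : ℝ}, 0 < a → 0 < b → Real.arctan (b / a) = π / 2 - Real.arctan (a / b) := by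
    intro a b ha hb
    rw [← Real.arctan_inv_of_pos (div_pos ha hb), inv_div]
  have h1 : 0 < 3 / 2 - u := by linarith [hu.2]
  have h2 : 0 < 3 / 2 + u := by linarith [hu.1]
  have h3 : 0 < 3 / 2 - v := by linarith [hv.2]
  have h4 : 0 < 3 / 2 + v := by linarith [hv.1]
  -- One pair of complementary angles at each of the four corners of the block gives 4 · π/2.
  rw [integral_wallKernel hu, integral_wallKernel hv, key h1 h3, key h1 h4, key h2 h3, key h2 h4]
  ring

/-! ### The double limit and its value. -/

theorem QuadRule.apply_comm {X Y : Type} {N m : ℕ} (q : QuadRule X N) (r : QuadRule Y m)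
    (f : X → Y → ℝ) :
    r.apply (fun s => q.apply fun y => f y s) = q.apply fun y => r.apply fun s => f y s := by
  unfold QuadRule.apply
  simp only [Finset.mul_sum]
  rw [Finset.sum_comm]
  exact Finset.sum_congr rfl fun i _ => Finset.sum_congr rfl fun j _ => by ring

theorem QuadRule.apply_add {X : Type} {n : ℕ} (q : QuadRule X n) (f g : X → ℝ) :
    q.apply (fun x => f x + g x) = q.apply f + q.apply g := by
  simp only [QuadRule.apply, mul_add, Finset.sum_add_distrib]

theorem QuadRule.apply_sum {X ι : Type} {n : ℕ} (q : QuadRule X n) (s : Finset ι)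
    (f : ι → X → ℝ) : q.apply (fun x => ∑ k ∈ s, f k x) = ∑ k ∈ s, q.apply (f k) := by
  simp only [QuadRule.apply, Finset.mul_sum]
  exact Finset.sum_comm

theorem QuadRule.apply_congr {X : Type} {n : ℕ} (q : QuadRule X n) {f g : X → ℝ}
    (h : ∀ i, f (q.node i) = g (q.node i)) : q.apply f = q.apply g :=
  Finset.sum_congr rfl fun i _ => by rw [h i]

theorem frontier_subset_openBlock {Ω : Set Plane} (h : closure Ω ⊆ openBlock) :
    frontier Ω ⊆ openBlock := frontier_subset_closure.trans h

/-- The boundary of the inclusion keeps a positive distance from the boundary of the block. -/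
theorem Inclusion.exists_margin (I : Inclusion) (hI : closure I.Ω ⊆ openBlock) :
    ∃ δ > 0, ∀ y ∈ frontier I.Ω, ∀ k, δ ≤ 3 / 2 - y k ∧ δ ≤ 3 / 2 + y k := by
  have hc : IsCompact (frontier I.Ω) :=
    I.isBounded.isCompact_closure.of_isClosed_subset isClosed_frontier frontier_subset_closure
  have hne : (frontier I.Ω).Nonempty := by
    rw [I.frontier_eq]
    exact Set.range_nonempty _
  have key : ∀ {g : Plane → ℝ}, Continuous g → (∀ y ∈ frontier I.Ω, 0 < g y) →
      ∃ δ > 0, ∀ y ∈ frontier I.Ω, δ ≤ g y := by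
    intro g hg h
    obtain ⟨y₀, hy₀, hmin⟩ := hc.exists_isMinOn hne hg.continuousOn
    exact ⟨g y₀, h _ hy₀, fun y hy => hmin hy⟩
  obtain ⟨δ, hδ, h⟩ := key
    (g := fun y => min (min (3 / 2 - y 0) (3 / 2 + y 0)) (min (3 / 2 - y 1) (3 / 2 + y 1)))
    (by fun_prop) fun y hy => by
      have h := frontier_subset_openBlock hI hy
      have h0 := h 0
      have h1 := h 1
      simp only [lt_min_iff]
      refine ⟨⟨?_, ?_⟩, ?_, ?_⟩ <;> linarith [h0.1, h0.2, h1.1, h1.2]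
  refine ⟨δ, hδ, fun y hy k => ?_⟩
  have := h y hy
  simp only [le_min_iff] at this
  fin_cases k
  exacts [this.1, this.2]

theorem exists_tendsto_wallKernel {q : (N : ℕ) → QuadRule Plane N} {T : (Plane → ℝ) → ℝ}
    (hq : ∀ f : Plane → ℝ, ContDiff ℝ ∞ f → Tendsto (fun N => (q N).apply f) atTop (𝓝 (T f)))
    {r : (m : ℕ) → QuadRule ℝ m} (hr : IsWallQuadrature r) {δ : ℝ} (hδ : 0 < δ) (k l : Fin 2)
    (hq' : ∀ N i, δ ≤ 3 / 2 - (q N).node i k ∧ δ ≤ 3 / 2 + (q N).node i k) :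
    ∃ L, Tendsto (fun p : ℕ × ℕ => (r p.2).apply fun s => (q p.1).apply fun y =>
      wallKernel (y k) (y l) s) (atTop ×ˢ atTop) (𝓝 L) := by
  have hcoord : ∀ k : Fin 2, ContDiff ℝ ∞ fun y : Plane => y k := fun k => by fun_prop
  choose L hL using fun n : ℤ => exists_tendsto_halfPlaneKernel hq hr.2
    (contDiff_const.sub (hcoord k)) ((hcoord l).add (contDiff_const (c := (n : ℝ)))) hδ
    fun N i => (hq' N i).1
  choose L' hL' using fun n : ℤ => exists_tendsto_halfPlaneKernel hq hr.2
    (contDiff_const.add (hcoord k)) ((hcoord l).add (contDiff_const (c := (n : ℝ)))) hδ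
    fun N i => (hq' N i).2
  refine ⟨∑ n ∈ Finset.Icc (-1 : ℤ) 1, (L n + L' n), ?_⟩
  simp only [wallKernel, QuadRule.apply_sum, QuadRule.apply_add]
  exact tendsto_finsetSum _ fun n _ => (hL n).add (hL' n)

/-- A double limit is the limit of the inner limits. -/
theorem tendsto_of_tendsto_prod_of_tendsto {F : ℕ × ℕ → ℝ} {g : ℕ → ℝ} {l : ℝ}
    (hF : Tendsto F (atTop ×ˢ atTop) (𝓝 l))
    (hg : ∀ N, Tendsto (fun m => F (N, m)) atTop (𝓝 (g N))) : Tendsto g atTop (𝓝 l) := by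
  rw [Metric.tendsto_nhds] at hF ⊢
  intro ε hε
  -- Passing to the limit in m weakens < to ≤, so ε/2 leaves room for the strict bound.
  filter_upwards [(hF (ε / 2) (half_pos hε)).curry] with N hN
  have h1 : Tendsto (fun m => dist (F (N, m)) l) atTop (𝓝 (dist (g N) l)) :=
    (hg N).dist tendsto_const_nhds
  have := le_of_tendsto h1 (hN.mono fun m hm => le_of_lt hm)
  linarith

/-- Since the joint limit is known to exist, it may be computed iteratively. For fixed N the sum
over sources is finite and each wall kernel is smooth, so m → ∞ gives the exact flux of every
source. -/
theorem tendsto_fluxSum {I : Inclusion} (hI : closure I.Ω ⊆ openBlock)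
    {q : (N : ℕ) → QuadRule Plane N} {qL qD : (m : ℕ) → QuadRule ℝ m}
    (hq : IsBoundaryQuadrature I q) (hL : IsWallQuadrature qL) (hD : IsWallQuadrature qD) :
    Tendsto (fun p : ℕ × ℕ => fluxSum (q p.1) (qL p.2) (qD p.2)) (atTop ×ˢ atTop)
      (𝓝 (-I.perimeter)) := by
  have hb : ∀ N j, (q N).node j ∈ openBlock := fun N j => frontier_subset_openBlock hI (hq.1 N j)
  obtain ⟨δ, hδ, hm⟩ := I.exists_margin hI
  obtain ⟨a, ha⟩ := exists_tendsto_wallKernel hq.2 hL hδ 0 1 fun N i => hm _ (hq.1 N i) 0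
  obtain ⟨b, hb'⟩ := exists_tendsto_wallKernel hq.2 hD hδ 1 0 fun N i => hm _ (hq.1 N i) 1
  have hlim := (ha.add hb').const_mul (-(1 / (2 * π)))
  have hfun : (fun p : ℕ × ℕ => fluxSum (q p.1) (qL p.2) (qD p.2)) = fun p => -(1 / (2 * π)) *
      ((qL p.2).apply (fun s => (q p.1).apply fun y => wallKernel (y 0) (y 1) s) +
        (qD p.2).apply fun s => (q p.1).apply fun y => wallKernel (y 1) (y 0) s) :=
    funext fun p => fluxSum_eq _ _ _ (hb p.1)
  rw [hfun]
  have hinner : ∀ N, Tendsto (fun m : ℕ => -(1 / (2 * π)) *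
      ((qL m).apply (fun s => (q N).apply fun y => wallKernel (y 0) (y 1) s) +
        (qD m).apply fun s => (q N).apply fun y => wallKernel (y 1) (y 0) s)) atTop
      (𝓝 (-(q N).apply fun _ => 1)) := by
    intro N
    have h1 : Tendsto (fun m : ℕ => -(1 / (2 * π)) * ((q N).apply fun y =>
        (qL m).apply (wallKernel (y 0) (y 1)) + (qD m).apply (wallKernel (y 1) (y 0)))) atTop
        (𝓝 (-(1 / (2 * π)) * ((q N).apply fun y =>
          (∫ s in (-(1 / 2) : ℝ)..(1 / 2), wallKernel (y 0) (y 1) s) +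
            ∫ s in (-(1 / 2) : ℝ)..(1 / 2), wallKernel (y 1) (y 0) s))) :=
      (tendsto_finsetSum _ fun j _ =>
        ((hL.2 _ (contDiff_wallKernel (hb N j 0) _)).add
          (hD.2 _ (contDiff_wallKernel (hb N j 1) _))).const_mul _).const_mul _
    convert h1 using 2
    · rw [(q N).apply_comm (qL _), (q N).apply_comm (qD _), ← QuadRule.apply_add]
    · have hval := (q N).apply_congr (g := fun _ => 2 * π)
        (f := fun y => (∫ s in (-(1 / 2) : ℝ)..(1 / 2), wallKernel (y 0) (y 1) s) +
          ∫ s in (-(1 / 2) : ℝ)..(1 / 2), wallKernel (y 1) (y 0) s)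
        fun j => integral_wallKernel_add (hb N j 0) (hb N j 1)
      rw [hval]
      simp only [QuadRule.apply, ← Finset.sum_mul, mul_one]
      field_simp
  have h2 := tendsto_of_tendsto_prod_of_tendsto hlim hinner
  have h3 : Tendsto (fun N => -(q N).apply fun _ => 1) atTop (𝓝 (-I.perimeter)) :=
    (hq.2 _ contDiff_const).neg
  rwa [tendsto_nhds_unique h2 h3] at hlim

theorem Inclusion.perimeter_pos (I : Inclusion) : 0 < I.perimeter := by
  have hc : Continuous fun t => ‖deriv I.x t‖ := (I.contDiff.continuous_deriv le_rfl).norm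
  unfold Inclusion.perimeter Inclusion.boundaryIntegral
  simp only [one_mul]
  exact intervalIntegral.intervalIntegral_pos_of_pos (hc.intervalIntegrable _ _)
    (fun t => norm_pos_iff.2 (I.deriv_ne_zero t)) Real.two_pi_pos

theorem exists_forall_ne_zero {F : ℕ × ℕ → ℝ} {l : ℝ} (hl : l ≠ 0)
    (hF : Tendsto F (atTop ×ˢ atTop) (𝓝 l)) :
    ∃ N₀ m₀ : ℕ, ∀ N m : ℕ, N₀ ≤ N → m₀ ≤ m → F (N, m) ≠ 0 := by
  have h := hF.eventually_ne hl
  rw [prod_atTop_atTop_eq, eventually_atTop] at h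
  obtain ⟨⟨N₀, m₀⟩, h⟩ := h
  exact ⟨N₀, m₀, fun N m hN hm => h (N, m) ⟨hN, hm⟩⟩

/-! ### The trapezoid and Gauss–Legendre rules. -/

/-- The sums of a continuous function over `N` equal panels of `[0, b]`, evaluated at the right
ends, converge to the integral. -/
theorem tendsto_rightRiemannSum {f : ℝ → ℝ} (hf : Continuous f) {b : ℝ} (hb : 0 < b) :
    Tendsto (fun N : ℕ => ∑ i : Fin N, b / N * f (b * ((i : ℝ) + 1) / N)) atTop
      (𝓝 (∫ t in (0 : ℝ)..b, f t)) := by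
  have huc : UniformContinuousOn f (Set.Icc 0 b) :=
    isCompact_Icc.uniformContinuousOn_of_continuous hf.continuousOn
  rw [Metric.uniformContinuousOn_iff] at huc
  rw [Metric.tendsto_atTop]
  intro ε hε
  -- An oscillation of at most ε/(2b) on each panel makes a total error of at most ε/2 over length
  -- b.
  obtain ⟨η, hη, h⟩ := huc (ε / (2 * b)) (by positivity)
  obtain ⟨N₀, hN₀⟩ := exists_nat_gt (b / η)
  refine ⟨N₀ + 1, fun N hN => ?_⟩
  have hNpos : (0 : ℝ) < N := by exact_mod_cast (Nat.succ_pos _).trans_le hN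
  have hstep : b / N < η := by
    rw [div_lt_iff₀ hNpos, mul_comm, ← div_lt_iff₀ hη]
    exact hN₀.trans_le (by exact_mod_cast (Nat.le_succ _).trans hN)
  have hsplit := intervalIntegral.sum_integral_adjacent_intervals
    (f := f) (μ := MeasureTheory.volume) (a := fun k : ℕ => b * (k : ℝ) / N) (n := N)
    fun k _ => hf.intervalIntegrable _ _
  have hend : b * (N : ℝ) / N = b := by field_simp
  simp only [hend, Nat.cast_zero, mul_zero, zero_div] at hsplit
  rw [← hsplit, Real.dist_eq, Fin.sum_univ_eq_sum_range
    (fun i => b / N * f (b * ((i : ℝ) + 1) / N)), ← Finset.sum_sub_distrib]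
  have hpanel : ∀ k ∈ Finset.range N, |b / N * f (b * ((k : ℝ) + 1) / N) -
      ∫ t in (b * (k : ℝ) / N)..(b * ((k + 1 : ℕ) : ℝ) / N), f t| ≤ ε / (2 * b) * (b / N) := by
    intro k hk
    have hk' : (k : ℝ) + 1 ≤ N := by exact_mod_cast Finset.mem_range.1 hk
    have hlen : b * ((k + 1 : ℕ) : ℝ) / N - b * (k : ℝ) / N = b / N := by
      push_cast
      ring
    have hle : b * (k : ℝ) / N ≤ b * ((k + 1 : ℕ) : ℝ) / N := by
      have : 0 < b / N := by positivity
      linarith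
    have htop : b * ((k + 1 : ℕ) : ℝ) / N ≤ b := by
      rw [div_le_iff₀ hNpos]
      push_cast
      gcongr
    have h0 : 0 ≤ b * (k : ℝ) / N := by positivity
    have hconst : b / N * f (b * ((k : ℝ) + 1) / N) =
        ∫ _ in (b * (k : ℝ) / N)..(b * ((k + 1 : ℕ) : ℝ) / N), f (b * ((k : ℝ) + 1) / N) := by
      rw [intervalIntegral.integral_const, hlen, smul_eq_mul]
    rw [hconst, ← intervalIntegral.integral_sub (by simp) (hf.intervalIntegrable _ _),
      ← Real.norm_eq_abs]
    refine (intervalIntegral.norm_integral_le_of_norm_le_const fun t ht => ?_).trans_eq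
      (by rw [hlen, abs_of_pos (by positivity)])
    rw [Set.uIoc_of_le hle] at ht
    have hd := h (b * ((k + 1 : ℕ) : ℝ) / N) ⟨h0.trans hle, htop⟩ t
      ⟨h0.trans ht.1.le, ht.2.trans htop⟩ (by
        rw [Real.dist_eq, abs_of_nonneg (by linarith [ht.2])]
        linarith [ht.1])
    rw [Real.dist_eq] at hd
    push_cast at hd
    exact hd.le
  calc _ ≤ ∑ k ∈ Finset.range N, ε / (2 * b) * (b / N) :=
        (Finset.abs_sum_le_sum_abs _ _).trans (Finset.sum_le_sum hpanel)
    _ = ε / 2 := by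
        rw [Finset.sum_const, Finset.card_range, nsmul_eq_mul]
        field_simp
    _ < ε := half_lt_self hε

theorem Inclusion.isBoundaryQuadrature_trapezoid (I : Inclusion) :
    IsBoundaryQuadrature I I.trapezoid := by
  refine ⟨fun N i => ?_, fun f hf => ?_⟩
  · rw [I.frontier_eq]
    exact ⟨_, rfl⟩
  · have hc : Continuous fun t => f (I.x t) * ‖deriv I.x t‖ :=
      (hf.continuous.comp I.contDiff.continuous).mul (I.contDiff.continuous_deriv le_rfl).norm
    convert tendsto_rightRiemannSum hc Real.two_pi_pos using 2
    · exact Finset.sum_congr rfl fun i _ => by simp only [Inclusion.trapezoid]; ring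
    · rfl

/-- The square of the nodal polynomial without its i-th factor has degree 2m - 2, so the rule
integrates it exactly, and only the i-th node contributes to the sum. -/
theorem IsGaussLegendre.weight_nonneg {m : ℕ} {q : QuadRule ℝ m} (hq : IsGaussLegendre q)
    (i : Fin m) : 0 ≤ q.weight i := by
  have hm : 0 < m := i.pos
  let r : Polynomial ℝ := ∏ j ∈ Finset.univ.erase i, (Polynomial.X - Polynomial.C (q.node j))
  have hr : r.natDegree = m - 1 := by
    rw [Polynomial.natDegree_prod_of_monic _ _ fun j _ => Polynomial.monic_X_sub_C _]
    simp
  have heval : ∀ s, r.eval s = ∏ j ∈ Finset.univ.erase i, (s - q.node j) := fun s => by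
    simp [r, Polynomial.eval_prod]
  have hpos : 0 < r.eval (q.node i) ^ 2 := by
    refine sq_pos_of_ne_zero ?_
    rw [heval, Finset.prod_ne_zero_iff]
    exact fun j hj => sub_ne_zero.2 fun h => (Finset.ne_of_mem_erase hj) (hq.1 h).symm
  have hexact := hq.2.2 (r ^ 2) (by rw [Polynomial.natDegree_pow, hr]; omega)
  have hsum : q.apply (fun s => (r ^ 2).eval s) = q.weight i * r.eval (q.node i) ^ 2 := by
    rw [QuadRule.apply, Finset.sum_eq_single i]
    · simp
    · intro j _ hj
      have : r.eval (q.node j) = 0 := by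
        rw [heval]
        exact Finset.prod_eq_zero (Finset.mem_erase.2 ⟨hj, Finset.mem_univ j⟩) (sub_self _)
      simp [this]
    · simp
  have hint : 0 ≤ ∫ s in (-(1 / 2) : ℝ)..(1 / 2), (r ^ 2).eval s :=
    intervalIntegral.integral_nonneg (by norm_num) fun s _ => by
      rw [Polynomial.eval_pow]
      positivity
  rw [← hexact, hsum] at hint
  exact nonneg_of_mul_nonneg_left hint hpos

theorem IsGaussLegendre.sum_weight {m : ℕ} {q : QuadRule ℝ m} (hq : IsGaussLegendre q)
    (hm : 0 < m) : ∑ i, q.weight i = 1 := by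
  have h := hq.2.2 1 (by simpa using hm)
  simp only [QuadRule.apply, Polynomial.eval_one, mul_one, intervalIntegral.integral_const] at h
  rw [h]
  norm_num

/-- Weierstrass approximation suffices, because nonnegative weights of total mass 1 do not amplify
the uniform error. -/
theorem isWallQuadrature_of_isGaussLegendre {q : (m : ℕ) → QuadRule ℝ m}
    (hq : ∀ m, IsGaussLegendre (q m)) : IsWallQuadrature q := by
  refine ⟨fun m => (hq m).2.1, fun f hf => ?_⟩
  rw [Metric.tendsto_atTop]
  intro ε hε
  obtain ⟨p, hp⟩ := exists_polynomial_near_of_continuousOn (-(1 / 2)) (1 / 2) f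
    hf.continuous.continuousOn (ε / 3) (by positivity)
  -- The extra 1 makes m positive, as required for total mass 1, and puts the degree of `p` below
  -- 2m.
  refine ⟨p.natDegree + 1, fun m hm => ?_⟩
  have h1 : |(q m).apply f - (q m).apply fun s => p.eval s| ≤ ε / 3 := by
    simp only [QuadRule.apply, ← Finset.sum_sub_distrib, ← mul_sub]
    calc _ ≤ ∑ i, (q m).weight i * (ε / 3) := by
          refine (Finset.abs_sum_le_sum_abs _ _).trans (Finset.sum_le_sum fun i _ => ?_)
          rw [abs_mul, abs_of_nonneg ((hq m).weight_nonneg i), abs_sub_comm]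
          exact mul_le_mul_of_nonneg_left (hp _ ((hq m).2.1 i)).le ((hq m).weight_nonneg i)
      _ = ε / 3 := by rw [← Finset.sum_mul, (hq m).sum_weight (by omega), one_mul]
  have h2 : |(∫ s in (-(1 / 2) : ℝ)..(1 / 2), p.eval s) -
      ∫ s in (-(1 / 2) : ℝ)..(1 / 2), f s| ≤ ε / 3 := by
    rw [← intervalIntegral.integral_sub (p.continuous.intervalIntegrable _ _)
      (hf.continuous.intervalIntegrable _ _), ← Real.norm_eq_abs]
    refine (intervalIntegral.norm_integral_le_of_norm_le_const fun t ht => ?_).trans_eq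
      (by norm_num : ε / 3 * |(1 / 2 : ℝ) - -(1 / 2)| = ε / 3)
    rw [Set.uIoc_of_le (by norm_num)] at ht
    exact (hp t ⟨ht.1.le, ht.2⟩).le
  rw [(hq m).2.2 p (by omega)] at h1
  rw [Real.dist_eq]
  calc _ ≤ _ := abs_sub_le _ (∫ s in (-(1 / 2) : ℝ)..(1 / 2), p.eval s) _
    _ < ε := by linarith

end PeriodicLaplace

theorem mainTheorem11 (I : Inclusion) (hI : closure I.Ω ⊆ openBlock) :
    (∀ (q : (N : ℕ) → QuadRule Plane N) (qL qD : (m : ℕ) → QuadRule ℝ m),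
      IsBoundaryQuadrature I q → IsWallQuadrature qL → IsWallQuadrature qD →
        Tendsto (fun p : ℕ × ℕ => fluxSum (q p.1) (qL p.2) (qD p.2)) (atTop ×ˢ atTop)
            (𝓝 (-I.perimeter)) ∧
          ∃ N₀ m₀ : ℕ, ∀ N m : ℕ, N₀ ≤ N → m₀ ≤ m → fluxSum (q N) (qL m) (qD m) ≠ 0) ∧
    (∀ qL qD : (m : ℕ) → QuadRule ℝ m,
      (∀ m, IsGaussLegendre (qL m)) → (∀ m, IsGaussLegendre (qD m)) →
        Tendsto (fun p : ℕ × ℕ => fluxSum (I.trapezoid p.1) (qL p.2) (qD p.2)) (atTop ×ˢ atTop)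
            (𝓝 (-I.perimeter)) ∧
          ∃ N₀ m₀ : ℕ, ∀ N m : ℕ, N₀ ≤ N → m₀ ≤ m →
            fluxSum (I.trapezoid N) (qL m) (qD m) ≠ 0) := by

  have hne : -I.perimeter ≠ 0 := (neg_neg_of_pos I.perimeter_pos).ne
  refine ⟨fun q qL qD hq hL hD => ?_, fun qL qD hL hD => ?_⟩
  · have h := tendsto_fluxSum hI hq hL hD
    exact ⟨h, exists_forall_ne_zero hne h⟩
  · have h := tendsto_fluxSum hI I.isBoundaryQuadrature_trapezoid
      (isWallQuadrature_of_isGaussLegendre hL) (isWallQuadrature_of_isGaussLegendre hD)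
    exact ⟨h, exists_forall_ne_zero hne h⟩
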